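/- **Theorem 3.1.** Consider the CLIQUE (congested clique) model: the vertex set is $[n]$, and in each synchronous round every vertex sends to every other vertex a message of $B$ bits (possibly different messages to different vertices), local computation being unrestricted. For a hypergraph $H=(V,E)$ on $V=[n]$, each vertex initially knows $n$, $r$, $B$, its own identity, and the set of hyperedges that contain it (each given as a set of vertices). A *triangle* of $H$ is a closed path $v_0,e_0,v_1,e_1,v_2,e_2,v_0$ of length 3, i.e. $e_i\in E$ and $v_i,v_{i+1}\in e_i$ for $i\in\mathbb{Z}/3$, considered up to the choice of starting vertex and direction. It is *simple* if $v_0,v_1,v_2$ are distinct and $e_0,e_1,e_2$ are distinct, and *induced* if moreover $v_i\notin e_{i+1}$ for all $i\in\mathbb{Z}/3$. In the *triangle enumeration problem* each vertex $v$ has to output a set $S_v$ of triangles such that the sets $S_v$ are pairwise disjoint and $\bigcup_{v} S_v$ is the set of all triangles of $H$; in the two variants of the problem, only the simple triangles, respectively only the induced triangles, are to be output. Let $B=\Theta(\log n)$. Then triangle enumeration, in each of the three variants, can be solved deterministically in $O(n^{r-5/3}/\log n)$ rounds of the CLIQUE model on $r$-uniform hypergraphs. Precisely: for every $c>0$ there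 is a constant $C>0$, depending only on $c$, such that for all integers $r\ge 0$, $n\ge 2$ and $B\ge c\log n$ there are an integer $0\le T\le C\,n^{r-5/3}/\log n$ and a deterministic algorithm with $B$-bit messages that solves triangle enumeration within $T$ rounds on every $r$-uniform hypergraph with vertex set $[n]$. -/

import Mathlib

namespace CliqueModel

/-! ### Hypergraphs and their triangles -/

/-- `H` is a hypergraph on the whole vertex type `α` all of whose edges have exactly `r` vertices. -/
def IsUniformOn {α : Type} (H : Hypergraph α) (r : ℕ) : Prop :=
  H.vertexSet = Set.univ ∧ ∀ e ∈ H.edgeSet, e.ncard = r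

/-- A cyclic sequence `v 0, e 0, v 1, e 1, v 2, e 2, v 0` of vertices and vertex sets;
indices are computed modulo 3. -/
@[ext]
structure TriSeq (α : Type) where
  v : Fin 3 → α
  e : Fin 3 → Set α

namespace TriSeq

variable {α : Type}

/-- The sequence is a closed path of length 3 in `H`: `e i` is an edge containing
`v i` and `v (i + 1)`. -/
def IsTriangle (H : Hypergraph α) (t : TriSeq α) : Prop :=
  ∀ i, t.e i ∈ H.edgeSet ∧ t.v i ∈ t.e i ∧ t.v (i + 1) ∈ t.e i

/-- The three vertices are distinct and the three edges are distinct. -/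
def IsSimple (t : TriSeq α) : Prop :=
  Function.Injective t.v ∧ Function.Injective t.e

/-- Simple, and no vertex lies on the opposite edge. -/
def IsInduced (t : TriSeq α) : Prop :=
  t.IsSimple ∧ ∀ i, t.v i ∉ t.e (i + 1)

/-- Two sequences describe the same cycle if they differ by the choice of the starting vertex
(first alternative), or by that choice and the direction of traversal (second alternative). -/
def SameCycle (s t : TriSeq α) : Prop :=
  (∃ k : Fin 3, ∀ i, t.v i = s.v (k + i) ∧ t.e i = s.e (k + i)) ∨
  (∃ k : Fin 3, ∀ i, t.v i = s.v (k - i) ∧ t.e i = s.e (k - i - 1))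

theorem sameCycle_refl (s : TriSeq α) : SameCycle s s :=
  Or.inl ⟨0, fun i => by simp⟩

theorem sameCycle_symm {s t : TriSeq α} (h : SameCycle s t) : SameCycle t s := by
  rcases h with ⟨k, h⟩ | ⟨k, h⟩
  · refine Or.inl ⟨-k, fun i => ?_⟩
    rw [(h (-k + i)).1, (h (-k + i)).2, add_neg_cancel_left]
    exact ⟨rfl, rfl⟩
  · refine Or.inr ⟨k, fun i => ?_⟩
    rw [(h (k - i)).1, (h (k - i - 1)).2]
    have h1 : k - (k - i) = i := by abel
    have h2 : k - (k - i - 1) - 1 = i := by abel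
    rw [h1, h2]
    exact ⟨rfl, rfl⟩

theorem sameCycle_trans {s t u : TriSeq α} (h : SameCycle s t) (h' : SameCycle t u) :
    SameCycle s u := by
  rcases h with ⟨k, h⟩ | ⟨k, h⟩ <;> rcases h' with ⟨l, h'⟩ | ⟨l, h'⟩
  · refine Or.inl ⟨k + l, fun i => ?_⟩
    rw [(h' i).1, (h' i).2, (h _).1, (h _).2, add_assoc]
    exact ⟨rfl, rfl⟩
  · refine Or.inr ⟨k + l, fun i => ?_⟩
    rw [(h' i).1, (h' i).2, (h _).1, (h _).2]
    have h1 : k + (l - i) = k + l - i := by abel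
    have h2 : k + (l - i - 1) = k + l - i - 1 := by abel
    rw [h1, h2]
    exact ⟨rfl, rfl⟩
  · refine Or.inr ⟨k - l, fun i => ?_⟩
    rw [(h' i).1, (h' i).2, (h _).1, (h _).2, sub_add_eq_sub_sub]
    exact ⟨rfl, rfl⟩
  · refine Or.inl ⟨k - l, fun i => ?_⟩
    rw [(h' i).1, (h' i).2, (h _).1, (h _).2]
    have h1 : k - (l - i) = k - l + i := by abel
    have h2 : k - (l - i - 1) - 1 = k - l + i := by abel
    rw [h1, h2]
    exact ⟨rfl, rfl⟩

end TriSeq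

instance triSetoid (α : Type) : Setoid (TriSeq α) where
  r := TriSeq.SameCycle
  iseqv := ⟨TriSeq.sameCycle_refl, TriSeq.sameCycle_symm, TriSeq.sameCycle_trans⟩

/-- Cycles of length 3, without a distinguished starting vertex or direction. -/
abbrev Tri (α : Type) : Type := Quotient (triSetoid α)

/-- The three usual variants of the enumeration task. -/
inductive TriKind
  | all
  | simple
  | induced

/-- The predicate that selects the triangles of the given kind. -/
def TriKind.Selects {α : Type} : TriKind → TriSeq α → Prop
  | .all, _ => True
  | .simple, t => t.IsSimple
  | .induced, t => t.IsInduced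

/-- The set of triangles of `H` of the given kind. -/
def triangles {α : Type} (kind : TriKind) (H : Hypergraph α) : Set (Tri α) :=
  {T | ∃ t : TriSeq α, Quotient.mk (triSetoid α) t = T ∧ t.IsTriangle H ∧ kind.Selects t}

/-- The output sets `S v` solve triangle enumeration on `H`: they are pairwise disjoint, and
together they consist of exactly the triangles of `H`. -/
def Enumerates {α : Type} (kind : TriKind) (H : Hypergraph α) (S : α → Set (Tri α)) : Prop :=
  Pairwise (fun u v => Disjoint (S u) (S v)) ∧ ⋃ v, S v = triangles kind H

/-! ### The CLIQUE model -/

/-- A deterministic synchronous algorithm on vertex set `V` in which, in each round, every vertex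
sends to every vertex a `B`-bit message, possibly different messages to different vertices. Local
computation and memory are unrestricted. `I` is the type of local inputs and `O` that of local
outputs. (A vertex may formally also send a message to itself; as it already knows the content,
this gives it no additional power.) -/
structure Algorithm (V I O : Type) (B : ℕ) where
  /-- local memory -/
  State : Type
  /-- initial memory of a vertex, from its identity and its local input -/
  init : V → I → State
  /-- `send s w` is the message to `w` sent by a vertex with memory `s` -/
  send : State → V → (Fin B → Bool)
  /-- new memory, from the old one and the messages received in the round, indexed by sender -/
  step : State → (V → (Fin B → Bool)) → State
  /-- local output -/
  output : State → O

namespace Algorithm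

variable {V I O : Type} {B : ℕ}

/-- The memory of each vertex after the given number of rounds on input `x`. -/
def run (A : Algorithm V I O B) (x : V → I) : ℕ → V → A.State
  | 0, v => A.init v (x v)
  | t + 1, v => A.step (A.run x t v) (fun u => A.send (A.run x t u) v)

/-- The local outputs if the execution is stopped after `T` rounds. -/
def result (A : Algorithm V I O B) (x : V → I) (T : ℕ) (v : V) : O :=
  A.output (A.run x T v)

end Algorithm

/-- What `v` knows initially about `H` (its 1-neighbourhood): its incident edges, each given
as the set of the vertices it contains. -/
def localInput {V : Type} (H : Hypergraph V) (v : V) : Set (Set V) :=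
  {e | e ∈ H.edgeSet ∧ v ∈ e}

/-- There is an algorithm in the CLIQUE model with `n` vertices `0, …, n - 1` and `B`-bit messages
that solves triangle enumeration in `T` rounds on every `r`-uniform hypergraph. The algorithm may
depend on `n`, `r`, `B`, but learns about the hypergraph only through the local inputs. -/
def SolvableIn (kind : TriKind) (r n B T : ℕ) : Prop :=
  ∃ A : Algorithm (Fin n) (Set (Set (Fin n))) (Set (Tri (Fin n))) B,
    ∀ H : Hypergraph (Fin n), IsUniformOn H r →
      Enumerates kind H (A.result (localInput H) T)

end CliqueModel

/-!
Cut the vertex set into `k ≈ n ^ (1/3)` blocks and assign each of the `k ^ 3 ≤ n` triples of blocks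
to a vertex `w`, writing `Q w` for the union of the triple. The vertices of a triangle with
distinct vertices all lie in some `Q w`, so each of its edges meets `Q w` at least twice; if two
vertices of a triangle coincide, all its edges share a vertex. Hence it suffices that `w` learns
which of the `r`-sets meeting `Q w` at least twice are edges, one bit for each set.

These bits travel over two hops. A member `owner e` of `e` tells an intermediate vertex `via e`
whether `e` is an edge, and `via e` passes this on to the vertices `w` in question. If `via` is
chosen well, every link carries `O(k * n ^ (r - 2)) = O(n ^ (r - 5/3))` bits, that is
`O(n ^ (r - 5/3) / B)` messages. For `r ≥ 3` the choice is the sum of the elements of `e` modulo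
`n`: given this sum, `e` is determined by all but one of its elements. For `r = 2` it is a vertex
that encodes residues of the two ends of `e`, with moduli such that the blocks split evenly into
residue classes.
-/

namespace CliqueModel

open Finset

/-! ### Composition of algorithms and transfer of bits -/

namespace Algorithm

variable {V I J O : Type} {B : ℕ}

/-- The memory, in the composition `seq` of two algorithms, of the vertex `v` that is in state `s`
of the first algorithm and has the given number of rounds of it ahead. The first algorithm is
suspended with one round less on the counter, since the next `step` is part of that round. -/
def seqState (A : Algorithm V I J B) (A' : Algorithm V J O B) :
    ℕ → V → A.State → (ℕ × V × A.State) ⊕ A'.State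
  | 0, v, s => Sum.inr (A'.init v (A.output s))
  | k + 1, v, s => Sum.inl (k, v, s)

/-- Sequential composition: `T` rounds of `A`, then `A'` on the local outputs of `A`. -/
def seq (T : ℕ) (A : Algorithm V I J B) (A' : Algorithm V J O B) : Algorithm V I O B where
  State := (ℕ × V × A.State) ⊕ A'.State
  init v i := seqState A A' T v (A.init v i)
  send := Sum.elim (fun p => A.send p.2.2) A'.send
  step := Sum.elim (fun p m => seqState A A' p.1 p.2.1 (A.step p.2.2 m))
    (fun s m => Sum.inr (A'.step s m))
  output := Sum.elim (fun p => A'.output (A'.init p.2.1 (A.output p.2.2))) A'.output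

variable (A : Algorithm V I J B) (A' : Algorithm V J O B) (x : V → I)

theorem run_seq_of_add_eq {T t k : ℕ} (h : t + k = T) (v : V) :
    (A.seq T A').run x t v = seqState A A' k v (A.run x t v) := by
  induction t generalizing k v with
  | zero => subst h; rw [zero_add]; rfl
  | succ t ih =>
    have ih := ih (k := k + 1) (by omega)
    simp only [run, ih]
    rfl

theorem run_seq_add (T t : ℕ) (v : V) :
    (A.seq T A').run x (T + t) v = Sum.inr (A'.run (A.result x T) t v) := by
  induction t generalizing v with
  | zero => exact run_seq_of_add_eq A A' x (add_zero T) v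
  | succ t ih =>
    rw [← add_assoc]
    simp only [run, ih]
    rfl

theorem result_seq (T T' : ℕ) :
    (A.seq T A').result x (T + T') = A'.result (A.result x T) T' := by
  funext v
  rw [result, run_seq_add]
  rfl

end Algorithm

/-- Some algorithm with `B`-bit messages turns the local inputs `x` into the local outputs `f x`
within `T` rounds. -/
def ComputableIn {V I O : Type} (B T : ℕ) (f : (V → I) → V → O) : Prop :=
  ∃ A : Algorithm V I O B, ∀ x, A.result x T = f x

namespace ComputableIn

variable {V I J O : Type} {B T T' R : ℕ}

theorem of_local (g : V → I → O) : ComputableIn B 0 fun x v => g v (x v) :=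
  ⟨{ State := O
     init := g
     send := fun _ _ _ => false
     step := fun s _ => s
     output := id }, fun _ => rfl⟩

theorem comp {g : (V → J) → V → O} {f : (V → I) → V → J} (hg : ComputableIn B T' g)
    (hf : ComputableIn B T f) : ComputableIn B (T + T') fun x => g (f x) := by
  obtain ⟨A, hA⟩ := hf
  obtain ⟨A', hA'⟩ := hg
  exact ⟨A.seq T A', fun x => by rw [Algorithm.result_seq, hA, hA']⟩

theorem map {f : (V → I) → V → J} (hf : ComputableIn B T f) (g : V → J → O) :
    ComputableIn B T fun x v => g v (f x v) :=
  (of_local g).comp hf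

theorem single_round (msg : V → I → V → Fin B → Bool) :
    ComputableIn B 1 fun (x : V → I) v => (x v, fun u => msg u (x u) v) :=
  ⟨{ State := V × I × (V → Fin B → Bool)
     init := fun v i => (v, i, fun _ _ => false)
     send := fun s => msg s.1 s.2.1
     step := fun s m => (s.1, s.2.1, m)
     output := Prod.snd }, fun _ => rfl⟩

theorem rounds (msg : V → I → V → Fin R → Fin B → Bool) :
    ComputableIn B R fun (x : V → I) v => (x v, fun u => msg u (x u) v) := by
  induction R with
  | zero =>
    convert of_local (B := B) fun (_ : V) (i : I) => (i, fun (_ : V) => Fin.elim0)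
      using 6
  | succ R ih =>
    have first := ih fun u i v j => msg u i v j.castSucc
    have last := single_round (B := B)
      fun u (y : I × (V → Fin R → Fin B → Bool)) v => msg u y.1 v (Fin.last R)
    convert (last.comp first).map fun _ z =>
      (z.1.1, fun u => Fin.snoc (α := fun _ => Fin B → Bool) (z.1.2 u) (z.2 u)) using 6
    exact (Fin.snoc_init_self _).symm

/-- The names `b ∈ S u v` of the bits sent from `u` to `v` are known in advance to both, so only
the values of the bits have to be transmitted. -/
theorem transfer {β : Type} (S : V → V → Finset β) (hS : ∀ u v, #(S u v) ≤ R * B)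
    (bit : V → I → β → Prop) :
    ComputableIn B R fun (x : V → I) v => (x v, fun u b => b ∈ S u v ∧ bit u (x u) b) := by
  classical
  have exists_slot (u v : V) : Nonempty (S u v ↪ Fin R × Fin B) :=
    Function.Embedding.nonempty_of_card_le (by simpa using hS u v)
  let slot (u v : V) : S u v ↪ Fin R × Fin B := (exists_slot u v).some
  have sent := rounds (B := B) fun u (i : I) v j b =>
    decide (∃ a, slot u v a = (j, b) ∧ bit u i a)
  convert sent.map fun v z => (z.1, fun u b => ∃ hb : b ∈ S u v,
    z.2 u (slot u v ⟨b, hb⟩).1 (slot u v ⟨b, hb⟩).2 = true) using 6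
  simp

end ComputableIn

/-! ### Distributing the triangles among the vertices -/

section Triangles

variable {α : Type} {H G : Hypergraph α} {t : TriSeq α}

theorem TriSeq.SameCycle.range_e_eq {s t : TriSeq α} (h : s.SameCycle t) :
    Set.range s.e = Set.range t.e := by
  have range_subset : ∀ {s t : TriSeq α}, s.SameCycle t → Set.range t.e ⊆ Set.range s.e := by
    rintro s t (⟨k, h⟩ | ⟨k, h⟩) _ ⟨i, rfl⟩ <;> exact ⟨_, (h i).2.symm⟩
  exact (range_subset (TriSeq.sameCycle_symm h)).antisymm (range_subset h)

theorem TriSeq.IsTriangle.mono (h : H.edgeSet ⊆ G.edgeSet) (ht : t.IsTriangle H) :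
    t.IsTriangle G :=
  fun i => ⟨h (ht i).1, (ht i).2⟩

/-- The hypergraph on all of `α` with edge set `E`: what a vertex sees of the input if the edges it
knows are those in `E`. -/
def ofEdges (E : Set (Set α)) : Hypergraph α where
  vertexSet := Set.univ
  edgeSet := E
  subset_vertexSet_of_mem_edgeSet' := fun e _ => Set.subset_univ e

theorem exists_responsible {P : α → Set α → Prop}
    (hP : ∀ t : TriSeq α, t.IsTriangle G → ∃ w, ∀ i, P w (t.e i)) :
    ∃ resp : Tri α → α, ∀ t : TriSeq α, t.IsTriangle G → ∀ i, P (resp ⟦t⟧) (t.e i) := by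
  have exists_vertex (Δ : Tri α) :
      ∃ w, ∀ t : TriSeq α, ⟦t⟧ = Δ → t.IsTriangle G → ∀ i, P w (t.e i) := by
    induction Δ using Quotient.inductionOn with | _ s
    by_cases h : ∃ t : TriSeq α, t ≈ s ∧ t.IsTriangle G
    · obtain ⟨t, hts, ht⟩ := h
      obtain ⟨w, hw⟩ := hP t ht
      refine ⟨w, fun t' ht's _ i => ?_⟩
      obtain ⟨j, hj⟩ : t'.e i ∈ Set.range t.e :=
        (Setoid.trans (Quotient.exact ht's) (Setoid.symm hts)).range_e_eq ▸ Set.mem_range_self i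
      exact hj ▸ hw j
    · exact ⟨s.v 0, fun t hts ht => absurd ⟨t, Quotient.exact hts, ht⟩ h⟩
  choose resp hresp using exists_vertex
  exact ⟨resp, fun t => hresp _ t rfl⟩

theorem enumerates_of_responsible {kind : TriKind} {K : α → Set (Set α)} (resp : Tri α → α)
    (hK : ∀ w, K w ⊆ H.edgeSet)
    (hresp : ∀ t : TriSeq α, t.IsTriangle H → ∀ i, t.e i ∈ K (resp ⟦t⟧)) :
    Enumerates kind H fun w => {Δ ∈ triangles kind (ofEdges (K w)) | resp Δ = w} := by
  refine ⟨fun u v huv => Set.disjoint_left.2 fun Δ hu hv => huv (hu.2.symm.trans hv.2), ?_⟩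
  ext Δ
  simp only [Set.mem_iUnion]
  constructor
  · rintro ⟨w, ⟨t, htΔ, ht, hkind⟩, -⟩
    exact ⟨t, htΔ, ht.mono (hK w), hkind⟩
  · rintro ⟨t, rfl, ht, hkind⟩
    exact ⟨resp ⟦t⟧, ⟨t, rfl, fun i => ⟨hresp t ht i, (ht i).2⟩, hkind⟩, rfl⟩

theorem exists_mem_edges_of_not_injective (ht : t.IsTriangle H)
    (hv : ¬ Function.Injective t.v) : ∃ w, ∀ i, w ∈ t.e i := by
  have mem_of_eq_succ (i : Fin 3) (hi : t.v i = t.v (i + 1)) : ∃ w, ∀ j, w ∈ t.e j := by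
    refine ⟨t.v i, fun j => ?_⟩
    have hj : j = i ∨ j = i + 1 ∨ j + 1 = i := by clear hi; decide +revert
    rcases hj with rfl | rfl | rfl
    · exact (ht j).2.1
    · exact hi ▸ (ht (i + 1)).2.1
    · exact (ht j).2.2
  simp only [Function.Injective, not_forall] at hv
  obtain ⟨i, j, hij, hne⟩ := hv
  have adjacent : j = i + 1 ∨ i = j + 1 := by clear hij; decide +revert
  rcases adjacent with rfl | rfl
  · exact mem_of_eq_succ i hij
  · exact mem_of_eq_succ j hij.symm

theorem exists_mem_edge_or_nontrivial_inter {Q : α → Set α}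
    (hQ : ∀ v : Fin 3 → α, ∃ w, ∀ i, v i ∈ Q w) (ht : t.IsTriangle H) :
    ∃ w, ∀ i, w ∈ t.e i ∨ (t.e i ∩ Q w).Nontrivial := by
  by_cases hv : Function.Injective t.v
  · obtain ⟨w, hw⟩ := hQ t.v
    have succ_ne (i : Fin 3) : i ≠ i + 1 := by decide +revert
    exact ⟨w, fun i => Or.inr ⟨t.v i, ⟨(ht i).2.1, hw i⟩, t.v (i + 1), ⟨(ht i).2.2, hw (i + 1)⟩,
      hv.ne (succ_ne i)⟩⟩
  · obtain ⟨w, hw⟩ := exists_mem_edges_of_not_injective ht hv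
    exact ⟨w, fun i => Or.inl (hw i)⟩

end Triangles

/-- The predicate `learns w e` says that `w` ends up knowing whether the set `e` is an edge. -/
theorem solvableIn_of_learns {kind : TriKind} {r n B T : ℕ}
    {F : (Fin n → Set (Set (Fin n))) → Fin n → Set (Set (Fin n))} (hF : ComputableIn B T F)
    (learns : Fin n → Set (Fin n) → Prop)
    (hFH : ∀ H, IsUniformOn H r → ∀ w, F (localInput H) w = {e ∈ H.edgeSet | learns w e})
    (hlearns : ∀ t : TriSeq (Fin n), t.IsTriangle (ofEdges {e | e.ncard = r}) →
      ∃ w, ∀ i, learns w (t.e i)) :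
    SolvableIn kind r n B T := by
  obtain ⟨resp, hresp⟩ := exists_responsible hlearns
  obtain ⟨A, hA⟩ := hF.map fun w E => {Δ ∈ triangles kind (ofEdges E) | resp Δ = w}
  refine ⟨A, fun H hH => ?_⟩
  rw [hA]
  refine enumerates_of_responsible resp (fun w => ?_) fun t ht i => ?_
  · exact hFH H hH w ▸ Set.sep_subset _ _
  · exact hFH H hH _ ▸ ⟨(ht i).1, hresp t (ht.mono hH.2) i⟩

theorem solvableIn_zero_of_le_one {kind : TriKind} {r n B : ℕ} (hr : r ≤ 1) :
    SolvableIn kind r n B 0 := by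
  refine solvableIn_of_learns (ComputableIn.of_local fun _ E => E) (fun w e => w ∈ e)
    (fun _ _ _ => rfl) fun t ht => exists_mem_edges_of_not_injective ht fun hinj => ?_
  have h01 : t.v 0 = t.v 1 :=
    (Set.ncard_le_one (Set.toFinite _)).1 ((ht 0).1.le.trans hr) _ (ht 0).2.1 _ (ht 0).2.2
  exact absurd (hinj h01) (by decide)

/-! ### Two-hop routing -/

/-- A way to route all `r`-sets of vertices over two hops, from a member `owner e` of `e` through
the intermediate vertex `via e` to every vertex `w` such that `e` meets `Q w` at least twice. No
link carries more than `L` sets in either hop. -/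
structure RelayScheme {V : Type*} [Fintype V] [DecidableEq V] (Q : V → Finset V) (r L : ℕ) where
  owner : Finset V → V
  via : Finset V → V
  owner_mem : ∀ e, #e = r → owner e ∈ e
  card_to_via_le : ∀ u p, #{e ∈ powersetCard r univ | owner e = u ∧ via e = p} ≤ L
  card_from_via_le : ∀ p w, #{e ∈ powersetCard r univ | via e = p ∧ (e ∩ Q w).Nontrivial} ≤ L

namespace RelayScheme

variable {V : Type} [Fintype V] [DecidableEq V] {Q : V → Finset V} {r L B R : ℕ}

theorem computableIn (s : RelayScheme Q r L) (hL : L ≤ R * B) :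
    ComputableIn B (R + R) fun (x : V → Set (Set V)) w => x w ∪ {e | ∃ f : Finset V, ↑f = e ∧
      #f = r ∧ (f ∩ Q w).Nontrivial ∧ e ∈ x (s.owner f)} := by
  have hop₁ := ComputableIn.transfer _ (fun u p => (s.card_to_via_le u p).trans hL)
    fun _ (E : Set (Set V)) (f : Finset V) => (f : Set V) ∈ E
  have hop₂ := ComputableIn.transfer _ (fun p w => (s.card_from_via_le p w).trans hL)
    fun _ (y : Set (Set V) × (V → Finset V → Prop)) f => y.2 (s.owner f) f
  convert (hop₂.comp hop₁).map fun _ z => z.1.1 ∪ {e | ∃ f : Finset V, ↑f = e ∧ ∃ p, z.2 p f}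
    using 6 with x w e
  simp only [mem_filter, mem_powersetCard_univ]
  grind

theorem localInput_union_relayed_eq (s : RelayScheme Q r L) {H : Hypergraph V}
    (hH : IsUniformOn H r) (w : V) :
    localInput H w ∪ {e | ∃ f : Finset V, ↑f = e ∧ #f = r ∧ (f ∩ Q w).Nontrivial ∧
        e ∈ localInput H (s.owner f)} =
      {e ∈ H.edgeSet | w ∈ e ∨ (e ∩ Q w).Nontrivial} := by
  ext e
  lift e to Finset V using e.toFinite
  have card_eq (he : (e : Set V) ∈ H.edgeSet) : #e = r := by simpa using hH.2 _ he
  have hnt : ((e : Set V) ∩ Q w).Nontrivial ↔ (e ∩ Q w).Nontrivial := by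
    rw [Finset.Nontrivial, coe_inter]
  simp only [Set.mem_union, localInput, Set.mem_ofPred_eq, hnt, mem_coe, coe_inj, exists_eq_left]
  have := s.owner_mem e
  tauto

end RelayScheme

theorem solvableIn_of_relayScheme {kind : TriKind} {r n B L R : ℕ} {Q : Fin n → Finset (Fin n)}
    (s : RelayScheme Q r L) (hL : L ≤ R * B)
    (hQ : ∀ v : Fin 3 → Fin n, ∃ w, ∀ i, v i ∈ Q w) :
    SolvableIn kind r n B (R + R) :=
  solvableIn_of_learns (s.computableIn hL) (fun w e => w ∈ e ∨ (e ∩ Q w).Nontrivial)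
    (fun _ hH w => s.localInput_union_relayed_eq hH w)
    fun _ ht => exists_mem_edge_or_nontrivial_inter (Q := fun w => Q w) hQ ht

theorem card_filter_subset_sum_eq_le {G : Type*} [AddCommGroup G] [Fintype G] [DecidableEq G]
    {A : Finset G} {r m : ℕ} (hr : r = #A + (m + 1)) (p : G) :
    #{e ∈ powersetCard r univ | A ⊆ e ∧ ∑ x ∈ e, x = p} ≤ Fintype.card G ^ m := by
  -- A set `e ⊇ A` with sum `p` is determined by all but one of its elements outside `A`.
  let complete (s : Finset G) : Finset G := insert (p - ∑ x ∈ A, x - ∑ x ∈ s, x) s ∪ A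
  have subset_image : {e ∈ powersetCard r (univ : Finset G) | A ⊆ e ∧ ∑ x ∈ e, x = p} ⊆
      (powersetCard m univ).image complete := by
    intro e he
    simp only [mem_filter, mem_powersetCard_univ] at he
    obtain ⟨hcard, hA, rfl⟩ := he
    have hsdiff : #(e \ A) = m + 1 := by rw [card_sdiff_of_subset hA]; omega
    obtain ⟨c, hc⟩ : (e \ A).Nonempty := card_pos.1 (by omega)
    refine mem_image.2 ⟨(e \ A).erase c, ?_, ?_⟩
    · rw [mem_powersetCard_univ, card_erase_of_mem hc, hsdiff, Nat.add_sub_cancel]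
    · have hsum : ∑ x ∈ e, x - ∑ x ∈ A, x - ∑ x ∈ (e \ A).erase c, x = c := by
        rw [← sum_sdiff hA, ← add_sum_erase _ _ hc]
        abel
      simp only [complete, hsum, insert_erase hc, sdiff_union_of_subset hA]
  calc _ ≤ #((powersetCard m univ).image complete) := card_le_card subset_image
    _ ≤ #(powersetCard m (univ : Finset G)) := card_image_le
    _ = (Fintype.card G).choose m := by rw [card_powersetCard, card_univ]
    _ ≤ Fintype.card G ^ m := Nat.choose_le_pow _ _

/-- In a group of vertices, the sum of the elements of a set can serve as the intermediate vertex
of that set. -/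
theorem exists_relayScheme_of_three_le {G : Type*} [AddCommGroup G] [Fintype G] [DecidableEq G]
    {Q : G → Finset G} {r l : ℕ} (hr : 3 ≤ r) (hl : 0 < l)
    (hQ : ∀ w, #(Q w) ^ 2 ≤ l * Fintype.card G) :
    Nonempty (RelayScheme Q r (l * Fintype.card G ^ (r - 2))) := by
  let owner (e : Finset G) : G := Classical.epsilon (· ∈ e)
  have owner_mem (e : Finset G) (he : #e = r) : owner e ∈ e :=
    Classical.epsilon_spec (card_pos.1 (by omega))
  refine ⟨⟨owner, fun e => ∑ x ∈ e, x, owner_mem, fun u p => ?_, fun p w => ?_⟩⟩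
  · calc _ ≤ #{e ∈ powersetCard r univ | {u} ⊆ e ∧ ∑ x ∈ e, x = p} := by
          refine card_le_card fun e he => ?_
          simp only [mem_filter, mem_powersetCard_univ] at he ⊢
          exact ⟨he.1, singleton_subset_iff.2 (he.2.1 ▸ owner_mem e he.1), he.2.2⟩
      _ ≤ Fintype.card G ^ (r - 2) :=
          card_filter_subset_sum_eq_le (by rw [card_singleton]; omega) p
      _ ≤ l * Fintype.card G ^ (r - 2) := Nat.le_mul_of_pos_left _ hl
  · calc _ ≤ #((Q w).offDiag.biUnion fun q =>
            {e ∈ powersetCard r univ | {q.1, q.2} ⊆ e ∧ ∑ x ∈ e, x = p}) := by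
          refine card_le_card fun e he => ?_
          simp only [mem_filter, mem_powersetCard_univ] at he
          obtain ⟨hcard, hsum, a, ha, b, hb, hab⟩ := he
          simp only [coe_inter, Set.mem_inter_iff, mem_coe] at ha hb
          simp only [mem_biUnion, mem_offDiag, mem_filter, mem_powersetCard_univ]
          exact ⟨(a, b), ⟨ha.2, hb.2, hab⟩, hcard, by grind, hsum⟩
      _ ≤ #(Q w).offDiag * Fintype.card G ^ (r - 3) := by
          refine card_biUnion_le_card_mul _ _ _ fun q hq => ?_
          exact card_filter_subset_sum_eq_le (by rw [card_pair (mem_offDiag.1 hq).2.2]; omega) p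
      _ ≤ #(Q w) ^ 2 * Fintype.card G ^ (r - 3) := by
          gcongr
          rw [offDiag_card, sq]
          exact Nat.sub_le _ _
      _ ≤ l * Fintype.card G * Fintype.card G ^ (r - 3) := by gcongr; exact hQ w
      _ = l * Fintype.card G ^ (r - 2) := by
          rw [mul_assoc, ← pow_succ', show r - 3 + 1 = r - 2 by omega]

/-! ### Cutting the vertex set into blocks -/

/-- The union of the blocks with numbers in `P`, if `0, …, n - 1` is cut into consecutive blocks
of length `m`. -/
def blockUnion (n m : ℕ) (P : Finset ℕ) : Finset (Fin n) := {v | (v : ℕ) / m ∈ P}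

theorem mem_blockUnion {n m : ℕ} {P : Finset ℕ} {v : Fin n} :
    v ∈ blockUnion n m P ↔ (v : ℕ) / m ∈ P := by
  simp [blockUnion]

theorem blockUnion_range_eq_univ {n k m : ℕ} (hn : n ≤ m * k) :
    blockUnion n m (range k) = univ :=
  eq_univ_of_forall fun v => mem_blockUnion.2 <| mem_range.2 <| Nat.div_lt_of_lt_mul <|
    v.2.trans_le hn

theorem card_filter_blockUnion_mod_eq_le {n m d N : ℕ} (hm : m = d * N) (hN : 0 < N)
    (P : Finset ℕ) (s : ℕ) : #{v ∈ blockUnion n m P | v.val % d = s} ≤ #P * N := by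
  suffices h : _ ≤ #(P ×ˢ range N) by rwa [card_product, card_range] at h
  refine card_le_card_of_injOn (fun v : Fin n => (v.val / m, v.val / d % N)) (fun v hv => ?_)
    fun v hv w hw h => ?_
  · exact mem_product.2 ⟨mem_blockUnion.1 (mem_filter.1 hv).1, mem_range.2 (Nat.mod_lt _ hN)⟩
  · simp only [Prod.mk.injEq, hm, ← Nat.div_div_eq_div_mul] at h
    have hdiv : (v : ℕ) / d = w / d := by
      rw [← Nat.div_add_mod (v / d : ℕ) N, h.1, h.2, Nat.div_add_mod]
    have hmod : (v : ℕ) % d = w % d := (mem_filter.1 hv).2.trans (mem_filter.1 hw).2.symm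
    exact Fin.ext (by rw [← Nat.div_add_mod v d, hdiv, hmod, Nat.div_add_mod])

theorem card_blockUnion_le {n m : ℕ} (hm : 0 < m) (P : Finset ℕ) :
    #(blockUnion n m P) ≤ #P * m := by
  simpa [Nat.mod_one] using
    card_filter_blockUnion_mod_eq_le (n := n) (one_mul m).symm hm P 0

theorem exists_blocks_assignment {n k m : ℕ} (hk : 0 < k) (hkn : k ^ m ≤ n) :
    ∃ P : Fin n → Finset ℕ, (∀ w, #(P w) ≤ m) ∧
      ∀ f : Fin m → ℕ, (∀ i, f i < k) → ∃ w, ∀ i, f i ∈ P w := by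
  have : NeZero k := ⟨hk.ne'⟩
  obtain ⟨ι⟩ : Nonempty ((Fin m → Fin k) ↪ Fin n) :=
    Function.Embedding.nonempty_of_card_le (by simpa using hkn)
  refine ⟨fun w => univ.image fun i => (Function.invFun ι w i : ℕ), fun w => ?_, fun f hf => ?_⟩
  · exact card_image_le.trans (card_fin m).le
  · obtain ⟨w, hw⟩ := Function.invFun_surjective ι.injective fun i => ⟨f i, hf i⟩
    exact ⟨w, fun i => mem_image.2 ⟨i, mem_univ i, by rw [hw]⟩⟩

theorem exists_code_mod_eq_and_div_eq {n k m : ℕ} (hk : 0 < k) (hm : 0 < m) (hn : m * k ≤ n) :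
    ∃ code : Fin n → Fin n → Fin n,
      ∀ a b, (code a b : ℕ) % m = a % m ∧ (code a b : ℕ) / m = b % k := by
  have hlt (a b : Fin n) : (a % m + m * (b % k) : ℕ) < n :=
    calc (a % m + m * (b % k) : ℕ) < m * (b % k + 1) := by
          rw [mul_add_one, add_comm]; gcongr; exact Nat.mod_lt _ hm
      _ ≤ m * k := Nat.mul_le_mul_left m (Nat.mod_lt _ hk)
      _ ≤ n := hn
  refine ⟨fun a b => ⟨_, hlt a b⟩, fun a b => ⟨?_, ?_⟩⟩
  · rw [Nat.add_mul_mod_self_left, Nat.mod_mod]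
  · rw [Nat.add_mul_div_left _ _ hm, Nat.div_eq_of_lt (Nat.mod_lt _ hm), zero_add]

theorem exists_pair_eq_of_card_eq_two (α : Type*) [Nonempty α] [DecidableEq α] :
    ∃ fst snd : Finset α → α, ∀ e, #e = 2 → e = {fst e, snd e} := by
  have exists_pair (e : Finset α) : ∃ a b, #e = 2 → e = {a, b} := by
    by_cases he : #e = 2
    · obtain ⟨a, b, -, h⟩ := card_eq_two.1 he
      exact ⟨a, b, fun _ => h⟩
    · exact ⟨Classical.arbitrary α, Classical.arbitrary α, fun h => absurd h he⟩
  choose fst snd h using exists_pair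
  exact ⟨fst, snd, h⟩

theorem subset_of_card_eq_two {α : Type*} [DecidableEq α] {e Q : Finset α} (he : #e = 2)
    (h : (e ∩ Q).Nontrivial) : e ⊆ Q :=
  inter_eq_left.1 (eq_of_subset_of_card_le inter_subset_left
    (he.trans_le (one_lt_card_iff_nontrivial.2 h)))

theorem card_le_mul_of_pair_eq {α : Type*} [DecidableEq α] {fst snd : Finset α → α}
    {S : Finset (Finset α)} (hpair : ∀ e ∈ S, e = {fst e, snd e}) {A C : Finset α}
    (hA : ∀ e ∈ S, fst e ∈ A) (hC : ∀ e ∈ S, snd e ∈ C) : #S ≤ #A * #C := by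
  rw [← card_product]
  refine card_le_card_of_injOn (fun e => (fst e, snd e))
    (fun e he => mem_product.2 ⟨hA e he, hC e he⟩) fun e he f hf h => ?_
  obtain ⟨h₁, h₂⟩ := Prod.mk.inj h
  rw [hpair e he, hpair f hf, h₁, h₂]

/-- The pair `{a, b}` travels from `b` through the vertex that encodes `a % k ^ 2` and `b % k`. -/
theorem exists_relayScheme_two {n k : ℕ} (hk : 0 < k) (hkn : k ^ 3 ≤ n) (hn : n ≤ 8 * k ^ 3)
    {P : Fin n → Finset ℕ} (hP : ∀ w, #(P w) ≤ 3) :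
    Nonempty (RelayScheme (fun w => blockUnion n (8 * k ^ 2) (P w)) 2 (576 * k)) := by
  have : NeZero n := ⟨((pow_pos hk 3).trans_le hkn).ne'⟩
  obtain ⟨code, hcode⟩ := exists_code_mod_eq_and_div_eq (m := k ^ 2) hk (by positivity)
    (hkn.trans' (pow_succ k 2).ge)
  obtain ⟨fst, snd, hpair⟩ := exists_pair_eq_of_card_eq_two (Fin n)
  have fst_mem (e : Finset (Fin n)) (he : #e = 2) : fst e ∈ e := by grind
  have snd_mem (e : Finset (Fin n)) (he : #e = 2) : snd e ∈ e := by grind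
  have card_fst_le (D : Finset ℕ) (s : ℕ) :
      #{v ∈ blockUnion n (8 * k ^ 2) D | v.val % k ^ 2 = s} ≤ #D * 8 :=
    card_filter_blockUnion_mod_eq_le (by ring) (by norm_num) D s
  have card_snd_le (D : Finset ℕ) (s : ℕ) :
      #{v ∈ blockUnion n (8 * k ^ 2) D | v.val % k = s} ≤ #D * (8 * k) :=
    card_filter_blockUnion_mod_eq_le (by ring) (by positivity) D s
  have blockUnion_range : blockUnion n (8 * k ^ 2) (range k) = univ :=
    blockUnion_range_eq_univ (hn.trans_eq (by ring))
  refine ⟨⟨snd, fun e => code (fst e) (snd e), snd_mem, fun u p => ?_, fun p w => ?_⟩⟩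
  · calc _ ≤ #{v ∈ blockUnion n (8 * k ^ 2) (range k) | v.val % k ^ 2 = p % k ^ 2} *
            #({u} : Finset (Fin n)) := by
          refine card_le_mul_of_pair_eq (fst := fst) (snd := snd) ?_ ?_ ?_ <;>
            simp only [mem_filter, mem_powersetCard_univ, mem_singleton]
          · exact fun e he => hpair e he.1
          · rintro e ⟨-, -, rfl⟩
            exact ⟨blockUnion_range ▸ mem_univ _, (hcode _ _).1.symm⟩
          · exact fun e he => he.2.1
      _ ≤ #(range k) * 8 * 1 := Nat.mul_le_mul (card_fst_le _ _) (card_singleton u).le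
      _ ≤ 576 * k := by rw [card_range]; omega
  · calc _ ≤ #{v ∈ blockUnion n (8 * k ^ 2) (P w) | v.val % k ^ 2 = p % k ^ 2} *
            #{v ∈ blockUnion n (8 * k ^ 2) (P w) | v.val % k = p / k ^ 2} := by
          refine card_le_mul_of_pair_eq (fst := fst) (snd := snd) ?_ ?_ ?_ <;>
            simp only [mem_filter, mem_powersetCard_univ]
          · exact fun e he => hpair e he.1
          · rintro e ⟨he, rfl, h⟩
            exact ⟨subset_of_card_eq_two he h (fst_mem e he), (hcode _ _).1.symm⟩
          · rintro e ⟨he, rfl, h⟩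
            exact ⟨subset_of_card_eq_two he h (snd_mem e he), (hcode _ _).2.symm⟩
      _ ≤ #(P w) * 8 * (#(P w) * (8 * k)) := Nat.mul_le_mul (card_fst_le _ _) (card_snd_le _ _)
      _ ≤ 3 * 8 * (3 * (8 * k)) := by gcongr <;> exact hP w
      _ = 576 * k := by ring

theorem exists_relayScheme {n k r : ℕ} (hr : 2 ≤ r) (hk : 0 < k) (hkn : k ^ 3 ≤ n)
    (hn : n ≤ 8 * k ^ 3) {P : Fin n → Finset ℕ} (hP : ∀ w, #(P w) ≤ 3) :
    Nonempty (RelayScheme (fun w => blockUnion n (8 * k ^ 2) (P w)) r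
      (576 * k * n ^ (r - 2))) := by
  obtain rfl | hr := hr.eq_or_lt
  · simpa using exists_relayScheme_two hk hkn hn hP
  · have : NeZero n := ⟨((pow_pos hk 3).trans_le hkn).ne'⟩
    have card_sq_le (w : Fin n) : #(blockUnion n (8 * k ^ 2) (P w)) ^ 2 ≤ 576 * k * n :=
      calc _ ≤ (#(P w) * (8 * k ^ 2)) ^ 2 := by
            gcongr; exact card_blockUnion_le (by positivity) _
        _ ≤ (3 * (8 * k ^ 2)) ^ 2 := by gcongr; exact hP w
        _ = 576 * k * k ^ 3 := by ring
        _ ≤ 576 * k * n := by gcongr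
    simpa using exists_relayScheme_of_three_le (G := Fin n) (l := 576 * k)
      (Q := fun w => blockUnion n (8 * k ^ 2) (P w)) hr (by positivity) (by simpa using card_sq_le)

theorem solvableIn_of_load_le {kind : TriKind} {r n k B R : ℕ} (hr : 2 ≤ r) (hk : 0 < k)
    (hkn : k ^ 3 ≤ n) (hn : n ≤ 8 * k ^ 3) (hR : 576 * k * n ^ (r - 2) ≤ R * B) :
    SolvableIn kind r n B (R + R) := by
  obtain ⟨P, hP, exists_blocks⟩ := exists_blocks_assignment hk hkn
  obtain ⟨s⟩ := exists_relayScheme hr hk hkn hn hP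
  refine solvableIn_of_relayScheme s hR fun v => ?_
  obtain ⟨w, hw⟩ := exists_blocks (fun i => v i / (8 * k ^ 2)) fun i =>
    Nat.div_lt_of_lt_mul ((v i).2.trans_le (hn.trans_eq (by ring)))
  exact ⟨w, fun i => mem_blockUnion.2 (hw i)⟩

theorem exists_pow_three_le_and_le (n : ℕ) (hn : n ≠ 0) :
    ∃ k, 0 < k ∧ k ^ 3 ≤ n ∧ n ≤ 8 * k ^ 3 := by
  have root_pos : 0 < Nat.nthRoot 3 n :=
    (Nat.le_nthRoot_iff three_ne_zero).2 (by simpa using Nat.one_le_iff_ne_zero.2 hn)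
  refine ⟨Nat.nthRoot 3 n, root_pos, (Nat.le_nthRoot_iff three_ne_zero).1 le_rfl, ?_⟩
  calc n ≤ (Nat.nthRoot 3 n + 1) ^ 3 := (Nat.lt_pow_nthRoot_add_one three_ne_zero n).le
    _ ≤ (2 * Nat.nthRoot 3 n) ^ 3 := by gcongr; omega
    _ = 8 * Nat.nthRoot 3 n ^ 3 := by ring

theorem mul_pow_le_rpow_sub {r n k : ℕ} (hr : 2 ≤ r) (hn : 0 < n) (hkn : k ^ 3 ≤ n) :
    (k * n ^ (r - 2) : ℝ) ≤ (n : ℝ) ^ ((r : ℝ) - 5 / 3) := by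
  have hn' : (0 : ℝ) < n := by exact_mod_cast hn
  have k_le : (k : ℝ) ≤ (n : ℝ) ^ (1 / 3 : ℝ) := by
    rw [one_div, Real.le_rpow_inv_iff_of_pos k.cast_nonneg hn'.le three_pos]
    exact_mod_cast hkn
  calc (k * n ^ (r - 2) : ℝ) ≤ (n : ℝ) ^ (1 / 3 : ℝ) * (n : ℝ) ^ (r - 2) := by gcongr
    _ = (n : ℝ) ^ ((r : ℝ) - 5 / 3) := by
      rw [← Real.rpow_natCast, ← Real.rpow_add hn', Nat.cast_sub hr]
      ring_nf

theorem exists_solvableIn_le_div_add_two (kind : TriKind) {r n B : ℕ} (hr : 2 ≤ r) (hn : 0 < n)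
    (hB : 0 < B) :
    ∃ T : ℕ, (T : ℝ) ≤ 1152 * (n : ℝ) ^ ((r : ℝ) - 5 / 3) / B + 2 ∧ SolvableIn kind r n B T := by
  obtain ⟨k, hk, hkn, hnk⟩ := exists_pow_three_le_and_le n hn.ne'
  have hload := mul_pow_le_rpow_sub hr hn hkn
  set load := 576 * k * n ^ (r - 2) with hload_def
  refine ⟨(load / B + 1) + (load / B + 1), ?_, solvableIn_of_load_le hr hk hkn hnk ?_⟩
  · calc _ = 2 * ((load / B : ℕ) : ℝ) + 2 := by push_cast; ring
      _ ≤ 2 * ((load : ℝ) / B) + 2 := by gcongr; exact Nat.cast_div_le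
      _ = 1152 * (k * n ^ (r - 2)) / B + 2 := by rw [hload_def]; push_cast; ring
      _ ≤ _ := by gcongr
  · exact (Nat.lt_mul_div_succ load hB).le.trans_eq (mul_comm _ _)

theorem log_le_three_mul_rpow_sub {r n : ℕ} (hr : 2 ≤ r) (hn : 0 < n) :
    Real.log n ≤ 3 * (n : ℝ) ^ ((r : ℝ) - 5 / 3) := by
  have hr' : (2 : ℝ) ≤ r := by exact_mod_cast hr
  calc Real.log n ≤ (n : ℝ) ^ (1 / 3 : ℝ) / (1 / 3) :=
        Real.log_le_rpow_div n.cast_nonneg (by norm_num)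
    _ = 3 * (n : ℝ) ^ (1 / 3 : ℝ) := by ring
    _ ≤ 3 * (n : ℝ) ^ ((r : ℝ) - 5 / 3) := by
      gcongr
      · exact_mod_cast hn
      · linarith

end CliqueModel

theorem theorem3p1 :
    ∀ c : ℝ, 0 < c → ∃ C : ℝ, 0 < C ∧
      ∀ (kind : CliqueModel.TriKind) (r n B : ℕ), 2 ≤ n → c * Real.log (n : ℝ) ≤ (B : ℝ) →
        ∃ T : ℕ, (T : ℝ) ≤ C * ((n : ℝ) ^ ((r : ℝ) - 5 / 3) / Real.log (n : ℝ)) ∧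
          CliqueModel.SolvableIn kind r n B T := by
  intro c hc
  refine ⟨1152 / c + 6, by positivity, fun kind r n B hn hB => ?_⟩
  have hlog : 0 < Real.log n := Real.log_pos (by exact_mod_cast hn)
  rcases Nat.lt_or_ge r 2 with hr | hr
  · exact ⟨0, by rw [Nat.cast_zero]; positivity,
      CliqueModel.solvableIn_zero_of_le_one (Nat.le_of_lt_succ hr)⟩
  have hB0 : 0 < B := by exact_mod_cast (mul_pos hc hlog).trans_le hB
  obtain ⟨T, hT, hsolv⟩ :=
    CliqueModel.exists_solvableIn_le_div_add_two kind hr (zero_lt_two.trans_le hn) hB0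
  refine ⟨T, ?_, hsolv⟩
  set X := (n : ℝ) ^ ((r : ℝ) - 5 / 3)
  have one_le : 1 ≤ 3 * X / Real.log n :=
    (one_le_div hlog).2 (CliqueModel.log_le_three_mul_rpow_sub hr (zero_lt_two.trans_le hn))
  calc (T : ℝ) ≤ 1152 * X / (c * Real.log n) + 2 * (3 * X / Real.log n) := by
        refine hT.trans (add_le_add ?_ (by linarith))
        gcongr
    _ = (1152 / c + 6) * (X / Real.log n) := by field_simp; ring
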